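/- Corollary (complete graph $\boxtimes$ regular graph). All graphs are simple and locally finite. Let $G$ be a complete graph with vertex degree $d_G$, and let $H$ be a regular graph with vertex degree $d_H$. Their strong product $G\boxtimes H$ has vertex set $V(G)\times V(H)$; two distinct vertices $(x_1,y_1),(x_2,y_2)$ are adjacent iff ($x_1=x_2$ or $x_1x_2\in E(G)$) and ($y_1=y_2$ or $y_1y_2\in E(H)$). For vertices $y_1,y_2$ of $H$ put $R_{y_1}(y_1,y_2)=N(y_1)\setminus\big((N(y_1)\cap N(y_2))\cup\{y_2\}\big)$, where $N(\cdot)$ is the set of neighbours in $H$ (so this set is empty if $y_1=y_2$). In a graph with graph distance $\mathrm{d}(\cdot,\cdot)$ and degrees $d_x$, for $\alpha\in[0,1]$ let $\mu_x^\alpha$ be the measure with mass $\alpha$ at $x$, mass $\frac{1-\alpha}{d_x}$ at every neighbour of $x$, and $0$ elsewhere. For two distinct vertices $x,y$ of the same component let $$\kappa_\alpha(x,y)=1-\frac{W(\mu_x^\alpha,\mu_y^\alpha)}{\mathrm{d}(x,y)},\qquad \kappa_{\rm LLY}(x,y)=\lim_{\alpha\to1^-}\frac{\kappa_\alpha(x,y)}{1-\alpha},$$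 where $W(\mu,\nu)=\inf_\pi\sum_{u,v}\mathrm{d}(u,v)\,\pi(u,v)$ is the Wasserstein distance, the infimum being over all $\pi:V\times V\to[0,1]$ with marginals $\mu$ and $\nu$. Then $G\boxtimes H$ is regular of degree $d:=d_G+d_H+d_Gd_H$, and for every edge $(x_1,y_1)(x_2,y_2)$ of $G\boxtimes H$ the limit defining $\kappa_{\rm LLY}((x_1,y_1),(x_2,y_2))$ exists and $$\kappa_{\rm LLY}((x_1,y_1),(x_2,y_2))=\begin{cases}\dfrac{d_H(d_G+1)}{d}\,\kappa_{\rm LLY}(y_1,y_2)&\text{if }R_{y_1}(y_1,y_2)\ne\emptyset,\\[2mm]\dfrac{d+1}{d}&\text{otherwise,}\end{cases}$$ $$\kappa_0((x_1,y_1),(x_2,y_2))=\begin{cases}\dfrac{d_Gd_H}{d}\,\kappa_{\rm LLY}(y_1,y_2)+\dfrac{d_H}{d}\,\kappa_0(y_1,y_2)&\text{if }R_{y_1}(y_1,y_2)\ne\emptyset,\\[2mm]\dfrac{d-1}{d}&\text{otherwise.}\end{cases}$$ In the first case of each formula $y_1y_2\in E(H)$ and the limit defining $\kappa_{\rm LLY}(y_1,y_2)$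 exists; the curvatures of $y_1,y_2$ are taken in $H$. -/

import Mathlib

open scoped ENNReal Topology

namespace GraphCurvature

/-- The strong product: distinct pairs `p`, `q` are adjacent iff `q.1` lies in the closed
neighbourhood of `p.1` in `G` and `q.2` lies in the closed neighbourhood of `p.2` in `H`. -/
def strongProd {V W : Type*} (G : SimpleGraph V) (H : SimpleGraph W) : SimpleGraph (V × W) where
  Adj p q := p ≠ q ∧ (p.1 = q.1 ∨ G.Adj p.1 q.1) ∧ (p.2 = q.2 ∨ H.Adj p.2 q.2)
  symm := ⟨fun _ _ h => ⟨h.1.symm, h.2.1.imp Eq.symm SimpleGraph.Adj.symm,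
    h.2.2.imp Eq.symm SimpleGraph.Adj.symm⟩⟩
  loopless := ⟨fun _ h => h.1 rfl⟩

/-- The strong product of two locally finite graphs is locally finite. -/
noncomputable instance strongProdLocallyFinite {V W : Type*} (G : SimpleGraph V)
    (H : SimpleGraph W) [G.LocallyFinite] [H.LocallyFinite] : (strongProd G H).LocallyFinite :=
  fun p => Set.Finite.fintype
    (((((G.neighborSet p.1).toFinite.insert p.1)).prod
      ((H.neighborSet p.2).toFinite.insert p.2)).subset (by
        rintro q ⟨-, h1, h2⟩
        exact ⟨h1.imp Eq.symm id, h2.imp Eq.symm id⟩))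

/-- `R_x(x, y) = N(x) \ (Δ(x, y) ∪ {y})` with `Δ(x, y) = N(x) ∩ N(y)`. -/
def remainingNeighbors {V : Type*} (G : SimpleGraph V) (x y : V) : Set V :=
  G.neighborSet x \ ((G.neighborSet x ∩ G.neighborSet y) ∪ {y})

open Classical in
/-- The mass function of the measure at `x` with idleness `α`. -/
noncomputable def idleMeasure {V : Type*} (G : SimpleGraph V) [G.LocallyFinite] (α : ℝ) (x : V) :
    V → ℝ :=
  fun y => if y = x then α else if G.Adj x y then (1 - α) / (G.degree x : ℝ) else 0

/-- `π : V × V → [0, 1]` has first marginal `μ` and second marginal `ν`. -/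
def IsCoupling {V : Type*} (μ ν : V → ℝ) (π : V → V → ℝ) : Prop :=
  (∀ x y, π x y ∈ Set.Icc (0 : ℝ) 1) ∧
  (∀ x, HasSum (fun y => π x y) (μ x)) ∧
  (∀ y, HasSum (fun x => π x y) (ν y))

/-- The Wasserstein distance for the graph distance, with values in `[0, ∞]`; vertices in
different components are at distance `∞`. -/
noncomputable def wasserstein {V : Type*} (G : SimpleGraph V) (μ ν : V → ℝ) : ℝ≥0∞ :=
  ⨅ (π : V → V → ℝ) (_ : IsCoupling μ ν π),
    ∑' x, ∑' y, ((G.edist x y : ℕ∞) : ℝ≥0∞) * ENNReal.ofReal (π x y)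

/-- The `α`-Ricci curvature `1 - W(μ_x^α, μ_y^α) / d(x, y)`. -/
noncomputable def ricciCurvature {V : Type*} (G : SimpleGraph V) [G.LocallyFinite] (α : ℝ)
    (x y : V) : ℝ :=
  1 - (wasserstein G (idleMeasure G α x) (idleMeasure G α y)).toReal / (G.dist x y : ℝ)

/-- `k` is the limit of `κ_α(x, y) / (1 - α)` as `α → 1` within `α < 1`. -/
def HasLLYCurvature {V : Type*} (G : SimpleGraph V) [G.LocallyFinite] (x y : V) (k : ℝ) : Prop :=
  Filter.Tendsto (fun α : ℝ => ricciCurvature G α x y / (1 - α)) (𝓝[<] 1) (𝓝 k)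

/-- The Lin–Lu–Yau curvature, the limit of `κ_α(x, y) / (1 - α)` as `α → 1`; it is meaningful
whenever `HasLLYCurvature G x y k` holds for some `k`. -/
noncomputable def llyCurvature {V : Type*} (G : SimpleGraph V) [G.LocallyFinite] (x y : V) : ℝ :=
  Filter.limUnder (𝓝[<] (1 : ℝ)) (fun α : ℝ => ricciCurvature G α x y / (1 - α))

end GraphCurvature

/-! Write n = d_G + 1 for the order of the complete factor. If y₁y₂ is an edge of H, the closed
neighbourhoods of (x₁, y₁) and (x₂, y₂) are n sheets, each a copy of the closed neighbourhood of y₁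
or y₂. Distances between their points are those in H, except that two points over the same vertex of
H coincide only within a sheet. So the transport problem for the product edge has nearly the same
cost matrix as the one for y₁y₂, which is the case n = 1.

Let T₁ be the least cost of a bijection between the closed neighbourhoods of y₁ and y₂, and T₀ that
between the open ones. For every n and the corresponding degree d, κ_0 = 1 - (T₀ + (n - 1) T₁) / d
(`IsLift.ricciCurvature_zero`) and κ_LLY = (d + 1 - n T₁) / d (`IsLift.hasLLYCurvature`). Taking n =
1 and n = d_G + 1 and eliminating T₀ and T₁ gives the formulas.

For the lower bounds on the Wasserstein distance, a coupling is summed over the sheets. This leaves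
a matrix whose marginals are constant except at the centre, and its cost is bounded by Birkhoff's
theorem: `sub_mul_add_mul_le_sum` treats a light centre (α = 0), `IsEdgeCost.mul_add_sub_le_sum` a
heavy one (α near 1). The upper bounds come from explicit assignments sheet by sheet.

If the remaining set is empty, the two ends of the product edge have the same closed neighbourhood.
Then T₁ = 0 and T₀ = 1 in the product itself, by `curvature_of_subset`. -/

namespace GraphCurvature

/-! ### Birkhoff's theorem and the exchange argument -/

/-- A linear lower bound valid on all bijections is valid on all doubly stochastic matrices. -/
theorem le_sum_mul_of_forall_equiv {I J : Type*} [Fintype I] [Fintype J] (e : I ≃ J)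
    {M : I → J → ℝ} (h0 : ∀ i j, 0 ≤ M i j) (hrow : ∀ i, ∑ j, M i j = 1)
    (hcol : ∀ j, ∑ i, M i j = 1) {c : I → J → ℝ} {L : ℝ}
    (h : ∀ σ : I ≃ J, L ≤ ∑ i, c i (σ i)) : L ≤ ∑ i, ∑ j, c i j * M i j := by
  classical
  have hM : Matrix.of (fun i i' => M i (e i')) ∈ doublyStochastic ℝ I := by
    rw [mem_doublyStochastic_iff_sum]
    refine ⟨fun i j => h0 _ _, fun i => ?_, fun j => hcol _⟩
    rw [← hrow i, ← e.sum_comp]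
    rfl
  have hconv : Convex ℝ {X : Matrix I I ℝ | L ≤ ∑ i, ∑ j, c i (e j) * X i j} := by
    refine convex_halfSpace_ge (f := fun X : Matrix I I ℝ => ∑ i, ∑ j, c i (e j) * X i j)
      ⟨fun X Y => ?_, fun r X => ?_⟩ L
    · simp only [Matrix.add_apply, mul_add, Finset.sum_add_distrib]
    · simp only [Matrix.smul_apply, smul_eq_mul, Finset.mul_sum]
      refine Finset.sum_congr rfl fun i _ => Finset.sum_congr rfl fun j _ => by ring
  rw [← SetLike.mem_coe, doublyStochastic_eq_convexHull_permMatrix] at hM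
  have key := convexHull_min (t := {X : Matrix I I ℝ | L ≤ ∑ i, ∑ j, c i (e j) * X i j})
    (by
      rintro _ ⟨σ, rfl⟩
      refine (h (σ.trans e)).trans (le_of_eq ?_)
      refine Finset.sum_congr rfl fun i _ => ?_
      simp [Equiv.Perm.permMatrix, PEquiv.toMatrix_apply, Equiv.toPEquiv_apply]) hconv hM
  refine key.trans (le_of_eq (Finset.sum_congr rfl fun i _ => ?_))
  rw [← e.sum_comp (fun j => c i j * M i j)]
  rfl

/-- Exchange argument: a bijection may be made to respect a partial matching `r` without
increasing the cost, provided that `c` satisfies the Monge condition along `r`. -/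
theorem exists_equiv_respecting {I J : Type*} [Fintype I] {r : I → J → Prop}
    (hr1 : ∀ i j j', r i j → r i j' → j = j') (hr2 : ∀ i i' j, r i j → r i' j → i = i')
    {c : I → J → ℕ} (hc : ∀ i j, r i j → ∀ u v, c i j + c u v ≤ c u j + c i v) (σ : I ≃ J) :
    ∃ σ' : I ≃ J, ∑ i, c i (σ' i) ≤ ∑ i, c i (σ i) ∧ ∀ i j, r i j → σ' i = j := by
  classical
  induction hn : (Finset.univ.filter fun i => ∃ j, r i j ∧ σ i ≠ j).card using
    Nat.strong_induction_on generalizing σ with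
  | _ n ih =>
    by_cases hall : ∀ i j, r i j → σ i = j
    · exact ⟨σ, le_rfl, hall⟩
    push Not at hall
    obtain ⟨i, j, hij, hne⟩ := hall
    set u := σ.symm j with hu
    have hσu : σ u = j := by simp [hu]
    have hui : u ≠ i := fun h => hne (by rw [← h, hσu])
    -- Now i receives its partner j, and u, which held j, takes σ i. The Monge condition bounds the
    -- cost; u has no partner that it could lose, since j is the partner of i ≠ u.
    let σ' : I ≃ J := (Equiv.swap i u).trans σ
    have h1 : σ' i = j := by simp [σ', hσu]
    have h2 : σ' u = σ i := by simp [σ']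
    have h3 : ∀ t, t ≠ i → t ≠ u → σ' t = σ t := fun t ht ht' => by
      simp [σ', Equiv.swap_apply_of_ne_of_ne ht ht']
    have hlt : (Finset.univ.filter fun t => ∃ j, r t j ∧ σ' t ≠ j).card < n := by
      rw [← hn]
      refine Finset.card_lt_card (Finset.ssubset_iff_subset_ne.2 ⟨?_, ?_⟩)
      · intro t ht
        simp only [Finset.mem_filter, Finset.mem_univ, true_and] at ht ⊢
        obtain ⟨k, hk, hk'⟩ := ht
        by_cases hti : t = i
        · subst hti
          exact absurd (h1.trans (hr1 _ _ _ hij hk)) hk'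
        by_cases htu : t = u
        · subst htu
          refine ⟨k, hk, fun h => hti (hr2 _ _ k hk ?_)⟩
          rw [← h, hσu]
          exact hij
        · exact ⟨k, hk, by rwa [h3 t hti htu] at hk'⟩
      · intro heq
        have : i ∈ Finset.univ.filter fun t => ∃ j, r t j ∧ σ t ≠ j := by
          simpa using ⟨j, hij, hne⟩
        rw [← heq] at this
        simp only [Finset.mem_filter, Finset.mem_univ, true_and] at this
        obtain ⟨k, hk, hk'⟩ := this
        exact hk' (h1.trans (hr1 _ _ _ hij hk))
    obtain ⟨τ, hτ, hτ'⟩ := ih _ hlt σ' rfl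
    refine ⟨τ, hτ.trans ?_, hτ'⟩
    rw [← Finset.add_sum_erase _ _ (Finset.mem_univ i),
      ← Finset.add_sum_erase _ (fun i => c i (σ i)) (Finset.mem_univ i),
      ← Finset.add_sum_erase _ _ (Finset.mem_erase.2 ⟨hui, Finset.mem_univ u⟩),
      ← Finset.add_sum_erase _ (fun i => c i (σ i)) (Finset.mem_erase.2 ⟨hui, Finset.mem_univ u⟩)]
    have := hc i j hij u (σ i)
    have hrest : ∑ x ∈ (Finset.univ.erase i).erase u, c x (σ' x) =
        ∑ x ∈ (Finset.univ.erase i).erase u, c x (σ x) :=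
      Finset.sum_congr rfl fun t ht => by
        simp only [Finset.mem_erase] at ht
        rw [h3 t ht.2.1 ht.1]
    rw [hrest]
    simp only [h1, h2, hσu]
    omega

/-! ### Lower bounds for matrices with an exceptional centre -/

/-- Abstract properties of the distances between the closed neighbourhoods of two adjacent
vertices; the centres are indexed by `none`. -/
structure IsEdgeCost {N N' : Type*} (c : Option N → Option N' → ℕ) : Prop where
  none_none : c none none = 1
  right_unique : ∀ i j j', c i j = 0 → c i j' = 0 → j = j'
  left_unique : ∀ i i' j, c i j = 0 → c i' j = 0 → i = i'
  triangle : ∀ i j, c i j = 0 → ∀ u v, c u v ≤ c u j + c i v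
  le_three : ∀ i j, c i j ≤ 3
  two_le_left : ∀ i, (∀ j, c i j ≠ 0) → 2 ≤ c i none
  two_le_right : ∀ j, (∀ i, c i j ≠ 0) → 2 ≤ c none j
  exists_left : ∃ i, c i none = 0
  exists_right : ∃ j, c none j = 0

theorem exists_some_eq_of_none {N N' : Type*} (σ : Option N ≃ Option N') (h : σ none = none) :
    ∃ τ : N ≃ N', ∀ x, σ (some x) = some (τ x) := by
  refine ⟨Equiv.removeNone σ, fun x => ?_⟩
  have hx : σ (some x) ≠ none := fun h' => by
    rw [← h] at h'
    exact Option.some_ne_none _ (σ.injective h')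
  obtain ⟨y, hy⟩ := Option.ne_none_iff_exists'.1 hx
  rw [Equiv.removeNone_some σ ⟨y, hy⟩]

section
variable {N N' : Type*} [Fintype N] {c : Option N → Option N' → ℕ}

/-- For a light centre: adding b - a to the centre-centre entry makes M equal to b times a doubly
stochastic matrix. Birkhoff's theorem is applied to a cost lowered at that entry, so that the added
mass is priced correctly. -/
theorem sub_mul_add_mul_le_sum [Fintype N'] (hc : c none none = 1) {T₀ T₁ : ℕ} (e : N ≃ N')
    (h₀ : ∀ τ : N ≃ N', T₀ ≤ ∑ x, c (some x) (some (τ x)))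
    (h₁ : ∀ σ : Option N ≃ Option N', T₁ ≤ ∑ i, c i (σ i)) (hT : T₁ ≤ T₀ + 1)
    {M : Option N → Option N' → ℝ} (hM : ∀ i j, 0 ≤ M i j) {a b : ℝ} (hab : a ≤ b) (hb : 0 < b)
    (hn : ∑ j, M none j = a) (hs : ∀ x, ∑ j, M (some x) j = b)
    (hn' : ∑ i, M i none = a) (hs' : ∀ x, ∑ i, M i (some x) = b) :
    (b - a) * T₀ + a * T₁ ≤ ∑ i, ∑ j, (c i j : ℝ) * M i j := by
  classical
  let E : Option N → Option N' → ℝ := fun i j => if i = none ∧ j = none then 1 else 0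
  -- The discount l on the centre-centre entry brings the bound T₀ + 1 for bijections fixing the
  -- centre down to T₁, the bound for all others. It is nonnegative, so the term in `M none none`
  -- may be dropped at the end.
  let l : ℝ := T₀ + 1 - T₁
  have hl : 0 ≤ l := by
    have : (T₁ : ℝ) ≤ T₀ + 1 := by exact_mod_cast hT
    simp only [l]; linarith
  have hE0 : ∀ i j, 0 ≤ E i j := fun i j => by simp only [E]; split_ifs <;> norm_num
  have key := le_sum_mul_of_forall_equiv (Equiv.optionCongr e)
    (M := fun i j => (M i j + (b - a) * E i j) / b)
    (fun i j => div_nonneg (add_nonneg (hM i j) (mul_nonneg (by linarith) (hE0 i j))) hb.le)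
    (fun i => by
      rw [← Finset.sum_div, Finset.sum_add_distrib, ← Finset.mul_sum]
      cases i with
      | none => rw [hn]; simp [E, hb.ne']
      | some x => rw [hs]; simp [E, hb.ne'])
    (fun j => by
      rw [← Finset.sum_div, Finset.sum_add_distrib, ← Finset.mul_sum]
      cases j with
      | none => rw [hn']; simp [E, hb.ne']
      | some x => rw [hs']; simp [E, hb.ne'])
    (c := fun i j => c i j - l * E i j) (L := T₁) (fun σ => by
      rw [Finset.sum_sub_distrib, ← Finset.mul_sum]
      by_cases hσ : σ none = none
      · obtain ⟨τ, hτ⟩ := exists_some_eq_of_none σ hσ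
        have h1 : ∑ i, E i (σ i) = 1 := by rw [Fintype.sum_option]; simp [E, hσ]
        have h2 : (T₀ : ℝ) ≤ ∑ x, (c (some x) (some (τ x)) : ℝ) := by exact_mod_cast h₀ τ
        rw [h1, Fintype.sum_option]
        simp only [hσ, hτ, hc, l]
        push_cast
        linarith
      · have h1 : ∑ i, E i (σ i) = 0 := by rw [Fintype.sum_option]; simp [E, hσ]
        rw [h1]
        have : (T₁ : ℝ) ≤ ∑ i, (c i (σ i) : ℝ) := by exact_mod_cast h₁ σ
        linarith)
  have hsum : ∑ i, ∑ j, ((c i j : ℝ) - l * E i j) * ((M i j + (b - a) * E i j) / b) =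
      (∑ i, ∑ j, (c i j : ℝ) * M i j + (b - a) - l * (M none none + (b - a))) / b := by
    have h3 : ∀ i j, ((c i j : ℝ) - l * E i j) * ((M i j + (b - a) * E i j) / b) =
        (c i j * M i j) / b +
          ((b - a) - l * (M none none + (b - a))) / b * E i j := by
      intro i j
      by_cases h : i = none ∧ j = none
      · obtain ⟨rfl, rfl⟩ := h
        simp [E, hc]
        field_simp
        ring
      · simp [E, h]
        ring
    simp only [h3, Finset.sum_add_distrib, ← Finset.mul_sum, ← Finset.sum_div]
    have h4 : ∑ i, ∑ j, E i j = 1 := by rw [Fintype.sum_option]; simp [E]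
    rw [h4]
    ring
  rw [hsum, le_div_iff₀ hb] at key
  have := mul_nonneg hl (hM none none)
  simp only [l] at key this
  nlinarith

/-- Doubling both centres increases the cost of any bijection by at least one. -/
theorem IsEdgeCost.add_one_le_sum_join (hc : IsEdgeCost c) {T₁ : ℕ}
    (h₁ : ∀ σ : Option N ≃ Option N', T₁ ≤ ∑ i, c i (σ i))
    (σ : Option (Option N) ≃ Option (Option N')) :
    T₁ + 1 ≤ ∑ i, c i.join (σ i).join := by
  classical
  -- The added centres are left out of r: with them, a point at cost 0 from a centre would have two
  -- partners.
  let r : Option (Option N) → Option (Option N') → Prop :=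
    fun i j => i ≠ none ∧ j ≠ none ∧ c i.join j.join = 0
  obtain ⟨τ, hτ, hr⟩ := exists_equiv_respecting (r := r) (c := fun i j => c i.join j.join)
    (by
      rintro (_ | i) (_ | j) (_ | j') ⟨h1, h2, h3⟩ ⟨h1', h2', h3'⟩ <;> simp_all
      exact hc.right_unique _ _ _ h3 h3')
    (by
      rintro (_ | i) (_ | i') (_ | j) ⟨h1, h2, h3⟩ ⟨h1', h2', h3'⟩ <;> simp_all
      exact hc.left_unique _ _ _ h3 h3')
    (by
      rintro i j ⟨-, -, h⟩ u v
      have := hc.triangle _ _ h u.join v.join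
      omega) σ
  refine le_trans ?_ hτ
  by_cases hn : τ none = none
  · obtain ⟨ρ, hρ⟩ := exists_some_eq_of_none τ hn
    have := h₁ ρ
    rw [Fintype.sum_option]
    simp only [hn, hρ, Option.join_none, Option.join_some, hc.none_none]
    omega
  · obtain ⟨v, hv⟩ := Option.ne_none_iff_exists'.1 hn
    have hu : τ.symm none ≠ none := fun h => hn (τ.symm_apply_eq.1 h).symm
    obtain ⟨u, hu⟩ := Option.ne_none_iff_exists'.1 hu
    have hu' : τ (some u) = none := by rw [← hu, Equiv.apply_symm_apply]
    -- Points at cost 0 are already paired with each other, so u and v have no partner and lie at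
    -- distance at least 2 from the centres. As 2 + 2 ≥ c u v + 1, sending u to v and centre to
    -- centre costs no more.
    have hv2 : 2 ≤ c none v := hc.two_le_right v fun i hi => by
      have := hr (some i) (some v) ⟨by simp, by simp, by simpa using hi⟩
      rw [← hv] at this
      exact absurd (τ.injective this) (by simp)
    have hu2 : 2 ≤ c u none := hc.two_le_left u fun j hj => by
      have := hr (some u) (some j) ⟨by simp, by simp, by simpa using hj⟩
      rw [hu'] at this
      exact absurd this (by simp)
    let τ' := (Equiv.swap none (some u)).trans τ
    have hτ'n : τ' none = none := by simp [τ', hu']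
    have hτ'u : τ' (some u) = some v := by simp [τ', hv]
    obtain ⟨ρ, hρ⟩ := exists_some_eq_of_none τ' hτ'n
    have hρu : ρ u = v := by
      have := hρ u
      rw [hτ'u] at this
      exact (Option.some_injective _ this).symm
    have hle := h₁ ρ
    have huv := hc.le_three u v
    rw [← Finset.add_sum_erase _ _ (Finset.mem_univ u), hρu] at hle
    rw [Fintype.sum_option, ← Finset.add_sum_erase _ _ (Finset.mem_univ u)]
    have hrest : ∑ x ∈ Finset.univ.erase u, c (some x).join (τ (some x)).join =
        ∑ x ∈ Finset.univ.erase u, c x (ρ x) := by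
      refine Finset.sum_congr rfl fun x hx => ?_
      have hx' : some x ≠ some u := by simpa using (Finset.mem_erase.1 hx).1
      have : τ (some x) = some (ρ x) := by
        rw [← hρ x]
        simp [τ', Equiv.swap_apply_of_ne_of_ne (Option.some_ne_none x) hx']
      rw [this]
      rfl
    rw [hrest]
    simp only [hv, hu', Option.join_none, Option.join_some]
    omega

/-- Splitting the weight of the centre equally between its two copies preserves sums. -/
theorem sum_join_div {A : Type*} [Fintype A] (F : Option A → ℝ) :
    ∑ i : Option (Option A), F i.join / (if i.join = none then 2 else 1) = ∑ i, F i := by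
  classical
  simp only [Fintype.sum_option, Option.join_none, Option.join_some]
  simp
  ring

/-- A centre of mass 2b becomes two points of mass b. The split matrix is b times a doubly
stochastic one, and Birkhoff's theorem reduces the bound to bijections with doubled centres. -/
theorem IsEdgeCost.mul_add_le_sum_of_two_mul [Fintype N'] (hc : IsEdgeCost c) (e : N ≃ N') {T₁ : ℕ}
    (h₁ : ∀ σ : Option N ≃ Option N', T₁ ≤ ∑ i, c i (σ i))
    {M : Option N → Option N' → ℝ} (hM : ∀ i j, 0 ≤ M i j) {b : ℝ} (hb : 0 < b)
    (hn : ∑ j, M none j = 2 * b) (hs : ∀ x, ∑ j, M (some x) j = b)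
    (hn' : ∑ i, M i none = 2 * b) (hs' : ∀ x, ∑ i, M i (some x) = b) :
    b * T₁ + b ≤ ∑ i, ∑ j, (c i j : ℝ) * M i j := by
  classical
  have key := le_sum_mul_of_forall_equiv (Equiv.optionCongr (Equiv.optionCongr e))
    (M := fun i j => M i.join j.join / (if j.join = none then 2 else 1) /
      (if i.join = none then 2 else 1) / b)
    (fun i j => div_nonneg (div_nonneg (div_nonneg (hM _ _) (by split_ifs <;> norm_num))
      (by split_ifs <;> norm_num)) hb.le)
    (fun i => by
      rw [← Finset.sum_div, ← Finset.sum_div, sum_join_div (fun j => M i.join j)]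
      rcases i with _ | _ | x
      · simp only [Option.join_none, hn, if_true]; field_simp
      · simp only [Option.join_some, hn, if_true]; field_simp
      · simp [hs, hb.ne'])
    (fun j => by
      simp only [div_right_comm _ (if j.join = none then (2 : ℝ) else 1)]
      rw [← Finset.sum_div, ← Finset.sum_div, sum_join_div (fun i => M i j.join)]
      rcases j with _ | _ | x
      · simp only [Option.join_none, hn', if_true]; field_simp
      · simp only [Option.join_some, hn', if_true]; field_simp
      · simp [hs', hb.ne'])
    (c := fun i j => (c i.join j.join : ℝ)) (L := T₁ + 1)
    (fun σ => by exact_mod_cast hc.add_one_le_sum_join h₁ σ)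
  have hsum : ∑ i : Option (Option N), ∑ j : Option (Option N'), (c i.join j.join : ℝ) *
      (M i.join j.join / (if j.join = none then 2 else 1) /
        (if i.join = none then 2 else 1) / b) = (∑ i, ∑ j, (c i j : ℝ) * M i j) / b := by
    rw [← sum_join_div (fun i => ∑ j, (c i j : ℝ) * M i j), Finset.sum_div]
    refine Finset.sum_congr rfl fun i _ => ?_
    rw [← sum_join_div (fun j => (c i.join j : ℝ) * M i.join j), Finset.sum_div, Finset.sum_div]
    refine Finset.sum_congr rfl fun j _ => ?_
    ring
  rw [hsum, le_div_iff₀ hb] at key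
  linarith

/-- A heavier centre is reduced to mass exactly 2b by mixing M with b times an optimal permutation
matrix, whose cost b T₁ is known. -/
theorem IsEdgeCost.mul_add_sub_le_sum [Fintype N'] (hc : IsEdgeCost c) {T₁ : ℕ}
    (e : N ≃ N') (h₁ : ∀ σ : Option N ≃ Option N', T₁ ≤ ∑ i, c i (σ i))
    (h₁' : ∃ σ : Option N ≃ Option N', ∑ i, c i (σ i) = T₁)
    {M : Option N → Option N' → ℝ} (hM : ∀ i j, 0 ≤ M i j) {a b : ℝ} (hab : 2 * b ≤ a)
    (hb : 0 < b) (hn : ∑ j, M none j = a) (hs : ∀ x, ∑ j, M (some x) j = b)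
    (hn' : ∑ i, M i none = a) (hs' : ∀ x, ∑ i, M i (some x) = b) :
    b * T₁ + (a - b) ≤ ∑ i, ∑ j, (c i j : ℝ) * M i j := by
  classical
  obtain ⟨σ, hσ⟩ := h₁'
  -- Solves l a + (1 - l) b = 2 b; the excess b in the doubled case becomes b / l = a - b for M.
  let l : ℝ := b / (a - b)
  have hab' : 0 < a - b := by linarith
  have hl : 0 < l := div_pos hb hab'
  have hl1 : l ≤ 1 := (div_le_one hab').2 (by linarith)
  have hla : l * a + (1 - l) * b = 2 * b := by
    have : l * (a - b) = b := div_mul_cancel₀ _ hab'.ne'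
    linarith
  let S : Option N → Option N' → ℝ := fun i j => if σ i = j then b else 0
  have hS1 : ∀ i, ∑ j, S i j = b := fun i => by simp [S]
  have hS2 : ∀ j, ∑ i, S i j = b := fun j => by
    have : ∀ i, S i j = if i = σ.symm j then b else 0 := fun i => by
      simp only [S, Equiv.eq_symm_apply]
    simp [this]
  have key := hc.mul_add_le_sum_of_two_mul e h₁ (M := fun i j => l * M i j + (1 - l) * S i j)
    (fun i j => add_nonneg (mul_nonneg hl.le (hM i j)) (mul_nonneg (by linarith)
      (by simp only [S]; split_ifs <;> linarith))) hb
    (by rw [Finset.sum_add_distrib, ← Finset.mul_sum, ← Finset.mul_sum, hn, hS1, hla])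
    (fun x => by
      rw [Finset.sum_add_distrib, ← Finset.mul_sum, ← Finset.mul_sum, hs, hS1]; ring)
    (by rw [Finset.sum_add_distrib, ← Finset.mul_sum, ← Finset.mul_sum, hn', hS2, hla])
    (fun x => by
      rw [Finset.sum_add_distrib, ← Finset.mul_sum, ← Finset.mul_sum, hs', hS2]; ring)
  have hcS : ∑ i, ∑ j, (c i j : ℝ) * S i j = b * T₁ := by
    rw [← hσ]
    push_cast
    rw [Finset.mul_sum]
    exact Finset.sum_congr rfl fun i _ => by simp [S, mul_comm]
  have hsum : ∑ i, ∑ j, (c i j : ℝ) * (l * M i j + (1 - l) * S i j) =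
      l * ∑ i, ∑ j, (c i j : ℝ) * M i j + (1 - l) * (b * T₁) := by
    rw [← hcS, Finset.mul_sum, Finset.mul_sum, ← Finset.sum_add_distrib]
    refine Finset.sum_congr rfl fun i _ => ?_
    rw [Finset.mul_sum, Finset.mul_sum, ← Finset.sum_add_distrib]
    exact Finset.sum_congr rfl fun j _ => by ring
  rw [hsum] at key
  have h5 : l * (b * T₁ + (a - b)) ≤ l * ∑ i, ∑ j, (c i j : ℝ) * M i j := by
    have : l * (a - b) = b := div_mul_cancel₀ _ hab'.ne'
    linarith
  exact le_of_mul_le_mul_left h5 hl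

end

/-! ### Transport by assignments and restriction of couplings -/

/-- Particle t carries mass `w t` from `P t` to `Q t`; several particles may share a vertex.
Massless particles need no distance bound, which is what frees the centre at α = 0. -/
theorem wasserstein_le_of_assignment {V T : Type*} [Fintype T] [DecidableEq V] (K : SimpleGraph V)
    {μ ν : V → ℝ} (P Q : T → V) {w : T → ℝ} (hw : ∀ t, 0 ≤ w t) (hw1 : ∑ t, w t ≤ 1)
    (hμ : ∀ z, μ z = ∑ t, if P t = z then w t else 0)
    (hν : ∀ z, ν z = ∑ t, if Q t = z then w t else 0)
    {c : T → ℕ} (hc : ∀ t, w t ≠ 0 → K.edist (P t) (Q t) ≤ c t) :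
    wasserstein K μ ν ≤ ENNReal.ofReal (∑ t, c t * w t) := by
  let π : V → V → ℝ := fun u v => ∑ t, if P t = u ∧ Q t = v then w t else 0
  have hπ : IsCoupling μ ν π := by
    refine ⟨fun u v => ⟨Finset.sum_nonneg fun t _ => ?_, (Finset.sum_le_sum fun t _ => ?_).trans hw1⟩,
      fun u => ?_, fun v => ?_⟩
    · split_ifs
      exacts [hw t, le_rfl]
    · split_ifs
      exacts [le_rfl, hw t]
    · rw [hμ]
      refine hasSum_sum fun t _ => ?_
      by_cases h : P t = u
      · simpa [h, eq_comm] using hasSum_ite_eq (Q t) (w t)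
      · simp [h]
    · rw [hν]
      refine hasSum_sum fun t _ => ?_
      by_cases h : Q t = v
      · simpa [h, eq_comm] using hasSum_ite_eq (P t) (w t)
      · simp [h]
  refine (iInf₂_le π hπ).trans ?_
  have h1 : ∀ u v, ((K.edist u v : ℕ∞) : ℝ≥0∞) * ENNReal.ofReal (π u v) =
      ∑ t, if P t = u ∧ Q t = v then
        ((K.edist (P t) (Q t) : ℕ∞) : ℝ≥0∞) * ENNReal.ofReal (w t) else 0 := by
    intro u v
    simp only [π]
    rw [ENNReal.ofReal_sum_of_nonneg (fun t _ => by split_ifs; exacts [hw t, le_rfl]),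
      Finset.mul_sum]
    refine Finset.sum_congr rfl fun t _ => ?_
    split_ifs with h
    · rw [h.1, h.2]
    · simp
  have h2 : ∑' u, ∑' v, ((K.edist u v : ℕ∞) : ℝ≥0∞) * ENNReal.ofReal (π u v) =
      ∑ t, ((K.edist (P t) (Q t) : ℕ∞) : ℝ≥0∞) * ENNReal.ofReal (w t) := by
    simp only [h1]
    simp only [Summable.tsum_finsetSum (fun _ _ => ENNReal.summable)]
    refine Finset.sum_congr rfl fun t _ => ?_
    rw [tsum_eq_single (P t) (fun u hu => by simp [hu.symm]),
      tsum_eq_single (Q t) (fun v hv => by simp [hv.symm])]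
    simp
  rw [h2, ENNReal.ofReal_sum_of_nonneg fun t _ => mul_nonneg (Nat.cast_nonneg _) (hw t)]
  refine Finset.sum_le_sum fun t _ => ?_
  by_cases ht : w t = 0
  · simp [ht]
  · rw [ENNReal.ofReal_mul (Nat.cast_nonneg _), ENNReal.ofReal_natCast]
    gcongr
    have := ENat.toENNReal_le.2 (hc t ht)
    simpa using this

theorem IsCoupling.eq_zero_of_left {V : Type*} {μ ν : V → ℝ} {π : V → V → ℝ}
    (hπ : IsCoupling μ ν π) {u : V} (hu : μ u = 0) (v : V) : π u v = 0 := by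
  have h := hπ.2.1 u
  rw [hu, hasSum_zero_iff_of_nonneg fun v => (hπ.1 u v).1] at h
  exact congrFun h v

theorem IsCoupling.eq_zero_of_right {V : Type*} {μ ν : V → ℝ} {π : V → V → ℝ}
    (hπ : IsCoupling μ ν π) {v : V} (hv : ν v = 0) (u : V) : π u v = 0 := by
  have h := hπ.2.2 v
  rw [hv, hasSum_zero_iff_of_nonneg fun u => (hπ.1 u v).1] at h
  exact congrFun h u

theorem IsCoupling.sum_left {V T : Type*} [Fintype T] {μ ν : V → ℝ} {π : V → V → ℝ}
    (hπ : IsCoupling μ ν π) {Q : T → V} (hQ : Function.Injective Q)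
    (hν : ∀ z, z ∉ Set.range Q → ν z = 0) (u : V) : ∑ t, π u (Q t) = μ u := by
  have h := (hQ.hasSum_iff (f := fun v => π u v)
    (fun z hz => hπ.eq_zero_of_right (hν z hz) u)).2 (hπ.2.1 u)
  exact (hasSum_fintype _).unique h

theorem IsCoupling.sum_right {V T : Type*} [Fintype T] {μ ν : V → ℝ} {π : V → V → ℝ}
    (hπ : IsCoupling μ ν π) {P : T → V} (hP : Function.Injective P)
    (hμ : ∀ z, z ∉ Set.range P → μ z = 0) (v : V) : ∑ t, π (P t) v = ν v := by
  have h := (hP.hasSum_iff (f := fun u => π u v)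
    (fun z hz => hπ.eq_zero_of_left (hμ z hz) v)).2 (hπ.2.2 v)
  exact (hasSum_fintype _).unique h

theorem IsCoupling.ofReal_le_cost {V A I J : Type*} [Fintype A] [Fintype I] [Fintype J]
    {K : SimpleGraph V} {μ ν : V → ℝ} {π : V → V → ℝ} (hπ : IsCoupling μ ν π)
    {P : A × I → V} {Q : A × J → V} (hP : Function.Injective P) (hQ : Function.Injective Q)
    {c : I → J → ℕ} (hc : ∀ a i b j, (c i j : ℕ∞) ≤ K.edist (P (a, i)) (Q (b, j))) :
    ENNReal.ofReal (∑ i, ∑ j, (c i j : ℝ) * ∑ a, ∑ b, π (P (a, i)) (Q (b, j))) ≤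
      ∑' u, ∑' v, ((K.edist u v : ℕ∞) : ℝ≥0∞) * ENNReal.ofReal (π u v) := by
  have h1 : ∑ i, ∑ j, (c i j : ℝ) * ∑ a, ∑ b, π (P (a, i)) (Q (b, j)) =
      ∑ s : A × I, ∑ t : A × J, (c s.2 t.2 : ℝ) * π (P s) (Q t) := by
    simp only [Fintype.sum_prod_type_right, Finset.mul_sum]
    refine Finset.sum_congr rfl fun i _ => ?_
    rw [Finset.sum_comm]
  rw [h1]
  have hpos : ∀ s t, 0 ≤ (c (Prod.snd s) (Prod.snd t) : ℝ) * π (P s) (Q t) := fun s t =>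
    mul_nonneg (Nat.cast_nonneg _) (hπ.1 _ _).1
  rw [ENNReal.ofReal_sum_of_nonneg fun s _ => Finset.sum_nonneg fun t _ => hpos s t]
  refine le_trans ?_ (ENNReal.tsum_comp_le_tsum_of_injective hP _)
  rw [tsum_fintype]
  refine Finset.sum_le_sum fun s _ => ?_
  rw [ENNReal.ofReal_sum_of_nonneg fun t _ => hpos s t]
  refine le_trans ?_ (ENNReal.tsum_comp_le_tsum_of_injective hQ _)
  rw [tsum_fintype]
  refine Finset.sum_le_sum fun t _ => ?_
  rw [ENNReal.ofReal_mul (Nat.cast_nonneg _), ENNReal.ofReal_natCast]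
  gcongr
  have := ENat.toENNReal_le.2 (hc s.1 s.2 t.1 t.2)
  simpa using this

/-! ### Minimal bijection costs and sheeted neighbourhoods -/

/-- `T` is the minimal cost of a bijection. -/
def IsMinCost {I J : Type*} [Fintype I] (c : I → J → ℕ) (T : ℕ) : Prop :=
  IsLeast (Set.range fun σ : I ≃ J => ∑ i, c i (σ i)) T

theorem exists_isMinCost {I J : Type*} [Fintype I] (e : I ≃ J) (c : I → J → ℕ) :
    ∃ T, IsMinCost c T := by
  have hne : (Set.range fun σ : I ≃ J => ∑ i, c i (σ i)).Nonempty := ⟨_, e, rfl⟩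
  exact ⟨_, Nat.sInf_mem hne, fun t ht => Nat.sInf_le ht⟩

theorem IsMinCost.le {I J : Type*} [Fintype I] {c : I → J → ℕ} {T : ℕ} (h : IsMinCost c T)
    (σ : I ≃ J) : T ≤ ∑ i, c i (σ i) := h.2 ⟨σ, rfl⟩

theorem IsMinCost.le_add_one {N N' : Type*} [Fintype N] {c : Option N → Option N' → ℕ}
    (hc : c none none = 1) {T₀ T₁ : ℕ} (h₀ : IsMinCost (fun x y => c (some x) (some y)) T₀)
    (h₁ : IsMinCost c T₁) : T₁ ≤ T₀ + 1 := by
  obtain ⟨τ, hτ⟩ := h₀.1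
  have := h₁.le (Equiv.optionCongr τ)
  rw [Fintype.sum_option] at this
  simp only [Equiv.optionCongr_apply, Option.map_none, Option.map_some, hc] at this
  simp only at hτ
  omega

/-- The closed neighbourhoods of `P (a₁, none)` and `Q (a₂, none)` in `K` are parametrized by `P`
and `Q`, and the distances between them are those of `c`, except that points at `c`-distance `0`
need coincide only if they lie in the same sheet. -/
structure IsLift {U A N N' : Type*} (K : SimpleGraph U) [K.LocallyFinite]
    (c : Option N → Option N' → ℕ) (P : A × Option N → U) (Q : A × Option N' → U) (a₁ a₂ : A)
    (d : ℕ) : Prop where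
  injective_left : Function.Injective P
  injective_right : Function.Injective Q
  range_left : ∀ z, z ∈ Set.range P ↔ z = P (a₁, none) ∨ K.Adj (P (a₁, none)) z
  range_right : ∀ z, z ∈ Set.range Q ↔ z = Q (a₂, none) ∨ K.Adj (Q (a₂, none)) z
  degree_left : K.degree (P (a₁, none)) = d
  degree_right : K.degree (Q (a₂, none)) = d
  le_edist : ∀ a i b j, (c i j : ℕ∞) ≤ K.edist (P (a, i)) (Q (b, j))
  edist_le : ∀ a i b j, (c i j = 0 → a = b) → K.edist (P (a, i)) (Q (b, j)) ≤ c i j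

theorem idleMeasure_eq_sum {U T : Type*} [Fintype T] [DecidableEq T] [DecidableEq U] (K : SimpleGraph U) [K.LocallyFinite]
    {P : T → U} (hP : Function.Injective P) (t₀ : T)
    (hr : ∀ z, z ∈ Set.range P ↔ z = P t₀ ∨ K.Adj (P t₀) z) {d : ℕ} (hd : K.degree (P t₀) = d)
    (α : ℝ) (z : U) : idleMeasure K α (P t₀) z =
      ∑ t, if P t = z then (if t = t₀ then α else (1 - α) / d) else 0 := by
  unfold idleMeasure
  rw [hd]
  by_cases hz : z ∈ Set.range P
  · obtain ⟨s, rfl⟩ := hz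
    have hs := (hr (P s)).1 ⟨s, rfl⟩
    simp only [hP.eq_iff] at hs ⊢
    rw [Finset.sum_ite_eq']
    by_cases h : s = t₀
    · simp [h]
    · simp [h, hs.resolve_left h]
  · have hs := mt (hr z).2 hz
    push Not at hs
    rw [if_neg hs.1, if_neg hs.2, Finset.sum_eq_zero]
    intro t _
    rw [if_neg fun h => hz ⟨t, h⟩]

section
variable {U A N N' : Type*} [Fintype A] [Fintype N] [Fintype N'] {K : SimpleGraph U}
  [K.LocallyFinite] {c : Option N → Option N' → ℕ} {P : A × Option N → U} {Q : A × Option N' → U}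
  {a₁ a₂ : A} {d : ℕ}

theorem sum_idleMeasure_comp {A I U : Type*} [Fintype A] (K : SimpleGraph U) [K.LocallyFinite]
    {P : A × Option I → U} (hP : Function.Injective P) (a₀ : A)
    (hr : ∀ z, z ∈ Set.range P ↔ z = P (a₀, none) ∨ K.Adj (P (a₀, none)) z) {d : ℕ}
    (hd : K.degree (P (a₀, none)) = d) (α : ℝ) (i : Option I) :
    ∑ a, idleMeasure K α (P (a₀, none)) (P (a, i)) =
      if i = none then α + (Fintype.card A - 1) * ((1 - α) / d)
      else Fintype.card A * ((1 - α) / d) := by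
  classical
  have h : ∀ a, idleMeasure K α (P (a₀, none)) (P (a, i)) =
      (1 - α) / d + if a = a₀ ∧ i = none then α - (1 - α) / d else 0 := by
    intro a
    have hs := (hr (P (a, i))).1 ⟨_, rfl⟩
    simp only [idleMeasure, hd, hP.eq_iff, Prod.mk.injEq] at hs ⊢
    by_cases h : a = a₀ ∧ i = none
    · simp [h]
    · rw [if_neg h, if_neg h, if_pos (hs.resolve_left h), add_zero]
  simp only [h, Finset.sum_add_distrib]
  by_cases hi : i = none
  · simp [hi]
    ring
  · simp [hi]

/-- Summing a coupling over pairs of sheets gives M. With β = (1 - α) / d, an ordinary index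
collects β from each sheet, while the centre collects α from one sheet and β from the others. -/
theorem IsLift.ofReal_le_wasserstein (hK : IsLift K c P Q a₁ a₂ d) {α L : ℝ}
    (h : ∀ M : Option N → Option N' → ℝ, (∀ i j, 0 ≤ M i j) →
      (∀ i, ∑ j, M i j = if i = none then α + (Fintype.card A - 1) * ((1 - α) / d)
        else Fintype.card A * ((1 - α) / d)) →
      (∀ j, ∑ i, M i j = if j = none then α + (Fintype.card A - 1) * ((1 - α) / d)
        else Fintype.card A * ((1 - α) / d)) →
      L ≤ ∑ i, ∑ j, (c i j : ℝ) * M i j) :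
    ENNReal.ofReal L ≤ wasserstein K (idleMeasure K α (P (a₁, none)))
      (idleMeasure K α (Q (a₂, none))) := by
  classical
  refine le_iInf₂ fun π hπ => ?_
  refine le_trans (ENNReal.ofReal_le_ofReal ?_)
    (hπ.ofReal_le_cost hK.injective_left hK.injective_right hK.le_edist)
  have hμ : ∀ z, z ∉ Set.range P → idleMeasure K α (P (a₁, none)) z = 0 := fun z hz => by
    have := mt (hK.range_left z).2 hz
    push Not at this
    simp [idleMeasure, this]
  have hν : ∀ z, z ∉ Set.range Q → idleMeasure K α (Q (a₂, none)) z = 0 := fun z hz => by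
    have := mt (hK.range_right z).2 hz
    push Not at this
    simp [idleMeasure, this]
  refine h _ (fun i j => Finset.sum_nonneg fun a _ => Finset.sum_nonneg fun b _ => (hπ.1 _ _).1)
    (fun i => ?_) (fun j => ?_)
  · rw [← sum_idleMeasure_comp K hK.injective_left a₁ hK.range_left hK.degree_left,
      Finset.sum_comm]
    refine Finset.sum_congr rfl fun a _ => ?_
    rw [← hπ.sum_left hK.injective_right hν, Fintype.sum_prod_type_right]
  · rw [← sum_idleMeasure_comp K hK.injective_right a₂ hK.range_right hK.degree_right]
    refine (Finset.sum_congr rfl fun i _ => Finset.sum_comm).trans ?_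
    rw [Finset.sum_comm]
    refine Finset.sum_congr rfl fun b _ => ?_
    rw [← hπ.sum_right hK.injective_left hμ, Fintype.sum_prod_type_right]

theorem IsLift.le_wasserstein_zero (hK : IsLift K c P Q a₁ a₂ d) (hc : IsEdgeCost c)
    (hd : 0 < d) {T₀ T₁ : ℕ} (h₀ : IsMinCost (fun x y => c (some x) (some y)) T₀)
    (h₁ : IsMinCost c T₁) :
    ENNReal.ofReal ((T₀ + (Fintype.card A - 1) * T₁) / d) ≤
      wasserstein K (idleMeasure K 0 (P (a₁, none))) (idleMeasure K 0 (Q (a₂, none))) := by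
  refine hK.ofReal_le_wasserstein fun M hM hr hs => ?_
  have hA : 0 < Fintype.card A := Fintype.card_pos_iff.2 ⟨a₁⟩
  obtain ⟨e, -⟩ := h₀.1
  have hd' : (0 : ℝ) < d := by exact_mod_cast hd
  have hA' : (0 : ℝ) < Fintype.card A := by exact_mod_cast hA
  have hβ : (0 : ℝ) < (1 - 0) / d := by simpa using hd'
  have := sub_mul_add_mul_le_sum hc.none_none e h₀.le h₁.le (h₀.le_add_one hc.none_none h₁) hM
    (a := 0 + (Fintype.card A - 1) * ((1 - 0) / d)) (b := Fintype.card A * ((1 - 0) / d))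
    (by linarith) (mul_pos hA' hβ) (by simpa using hr none)
    (fun x => by simpa using hr (some x)) (by simpa using hs none)
    (fun x => by simpa using hs (some x))
  refine le_trans (le_of_eq ?_) this
  field_simp
  ring

theorem IsLift.le_wasserstein (hK : IsLift K c P Q a₁ a₂ d) (hc : IsEdgeCost c)
    (hd : 0 < d) {T₀ T₁ : ℕ} (h₀ : IsMinCost (fun x y => c (some x) (some y)) T₀)
    (h₁ : IsMinCost c T₁) {α : ℝ} (hα : α < 1)
    (hα' : (Fintype.card A + 1) * ((1 - α) / d) ≤ α) :
    ENNReal.ofReal (Fintype.card A * ((1 - α) / d) * T₁ + (α - (1 - α) / d)) ≤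
      wasserstein K (idleMeasure K α (P (a₁, none))) (idleMeasure K α (Q (a₂, none))) := by
  refine hK.ofReal_le_wasserstein fun M hM hr hs => ?_
  have hA : 0 < Fintype.card A := Fintype.card_pos_iff.2 ⟨a₁⟩
  obtain ⟨e, -⟩ := h₀.1
  have hA' : (0 : ℝ) < Fintype.card A := by exact_mod_cast hA
  have hβ : (0 : ℝ) < (1 - α) / d := div_pos (by linarith) (by exact_mod_cast hd)
  have := hc.mul_add_sub_le_sum e h₁.le h₁.1 hM (b := Fintype.card A * ((1 - α) / d))
    (a := α + (Fintype.card A - 1) * ((1 - α) / d))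
    (by linarith) (mul_pos hA' hβ) (by simpa using hr none)
    (fun x => by simpa using hr (some x)) (by simpa using hs none)
    (fun x => by simpa using hs (some x))
  refine le_trans (le_of_eq ?_) this
  ring

end

/-! ### Upper bounds from explicit assignments -/

section
variable {U A N N' : Type*} [Fintype A] [Fintype N] {K : SimpleGraph U}
  [K.LocallyFinite] {c : Option N → Option N' → ℕ} {P : A × Option N → U} {Q : A × Option N' → U}
  {a₁ a₂ : A} {d : ℕ}

theorem IsMinCost.exists_respecting (hc : IsEdgeCost c) {T : ℕ} (h : IsMinCost c T) :
    ∃ σ : Option N ≃ Option N', ∑ i, c i (σ i) = T ∧ ∀ i j, c i j = 0 → σ i = j := by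
  obtain ⟨σ, hσ⟩ := h.1
  obtain ⟨τ, hτ, hr⟩ := exists_equiv_respecting (r := fun i j => c i j = 0) (c := c)
    hc.right_unique hc.left_unique
    (fun i j hij u v => by have := hc.triangle i j hij u v; omega) σ
  exact ⟨τ, le_antisymm (hτ.trans hσ.le) (h.le τ), hr⟩

theorem sum_ite_eq_none_weight {A I : Type*} [Fintype A] [Fintype I] [DecidableEq A]
    [DecidableEq I] (a₀ : A) (f : A → Option I → ℝ) (α β : ℝ) :
    ∑ t : A × Option I, f t.1 t.2 * (if t = (a₀, none) then α else β) =
      β * ∑ a, ∑ i, f a i + (α - β) * f a₀ none := by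
  have h : ∀ t : A × Option I, f t.1 t.2 * (if t = (a₀, none) then α else β) =
      β * f t.1 t.2 + if t = (a₀, none) then (α - β) * f t.1 t.2 else 0 := by
    intro t
    split_ifs <;> ring
  simp only [h, Finset.sum_add_distrib]
  rw [Finset.sum_ite_eq' , ← Finset.mul_sum, Fintype.sum_prod_type]
  simp

theorem sum_ite_weight {T : Type*} [Fintype T] [DecidableEq T] (t₀ : T) (f : T → Prop)
    [DecidablePred f] (α β : ℝ) : (∑ t, if f t then (if t = t₀ then α else β) else 0) =
      (if f t₀ then α - β else 0) + ∑ t, if f t then β else 0 := by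
  have : ∀ t, (if f t then (if t = t₀ then α else β) else 0) =
      (if t = t₀ then (if f t₀ then α - β else 0) else 0) + if f t then β else 0 := by
    intro t
    by_cases h : t = t₀
    · subst h
      simp only [if_true]
      split_ifs <;> ring
    · simp [h]
  rw [Finset.sum_congr rfl fun t _ => this t, Finset.sum_add_distrib, Finset.sum_ite_eq']
  simp

theorem sum_weight {A I : Type*} [Fintype A] [Fintype I] [DecidableEq A]
    [DecidableEq I] (a₀ : A) (α β : ℝ) :
    ∑ t : A × Option I, (if t = (a₀, none) then α else β) =
      Fintype.card A * (Fintype.card I + 1) * β + (α - β) := by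
  have := sum_ite_eq_none_weight (I := I) a₀ (fun _ _ => 1) α β
  simp only [one_mul] at this
  rw [this]
  simp
  ring

/-- Sheet a₁ uses an optimal bijection of open neighbourhoods, leaving its massless centre aside;
the other n - 1 sheets use an optimal bijection of closed ones. When a₁ ≠ a₂, sheets must be
corrected so that the two massless centres correspond. -/
theorem IsLift.wasserstein_zero_le [Fintype N'] (hK : IsLift K c P Q a₁ a₂ d) (hc : IsEdgeCost c)
    (hd : 0 < d) (hcard : d + 1 = Fintype.card A * (Fintype.card N + 1))
    {T₀ T₁ : ℕ} (h₀ : IsMinCost (fun x y => c (some x) (some y)) T₀) (h₁ : IsMinCost c T₁) :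
    wasserstein K (idleMeasure K 0 (P (a₁, none))) (idleMeasure K 0 (Q (a₂, none))) ≤
      ENNReal.ofReal ((T₀ + (Fintype.card A - 1) * T₁) / d) := by
  classical
  obtain ⟨σ, hσ, hr⟩ := h₁.exists_respecting hc
  obtain ⟨τ, hτ⟩ := h₀.1
  obtain ⟨i₀, hi₀⟩ := hc.exists_left
  have hi₀n : i₀ ≠ none := by
    rintro rfl
    simp [hc.none_none] at hi₀
  let ρ : A → (Option N ≃ Option N') := fun a => if a = a₁ then Equiv.optionCongr τ else σ
  have hρ1 : ρ a₁ = Equiv.optionCongr τ := if_pos rfl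
  have hρ : ∀ a, a ≠ a₁ → ρ a = σ := fun a ha => if_neg ha
  -- `s'` moves the image of the source centre to the target centre, which would separate the
  -- zero-cost pair (i₀, centre) in sheet a₂. Swapping the sources over i₀ by `s` puts that pair
  -- back into one sheet. Neither swap changes second coordinates, so costs are unaffected.
  let s : Equiv.Perm (A × Option N) := Equiv.swap (a₁, i₀) (a₂, i₀)
  let s' : Equiv.Perm (A × Option N') := Equiv.swap (a₁, none) (a₂, none)
  let q : A × Option N ≃ A × Option N' :=
    (s.trans (Equiv.prodShear (Equiv.refl A) ρ)).trans s'
  have hs2 : ∀ t, (s t).2 = t.2 := fun t => by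
    simp only [s, Equiv.swap_apply_def]
    split_ifs with h h <;> simp [h]
  have hs'2 : ∀ t, (s' t).2 = t.2 := fun t => by
    simp only [s', Equiv.swap_apply_def]
    split_ifs with h h <;> simp [h]
  have hsc : s (a₁, none) = (a₁, none) :=
    Equiv.swap_apply_of_ne_of_ne (by simp [hi₀n.symm]) (by simp [hi₀n.symm])
  have hq : ∀ t, q t = s' ((s t).1, ρ (s t).1 t.2) := fun t => by
    rw [← hs2 t]
    rfl
  have hqc : q (a₁, none) = (a₂, none) := by
    rw [hq, hsc]
    simp [hρ1, s']
  have hq2 : ∀ t, (q t).2 = ρ (s t).1 t.2 := fun t => by rw [hq, hs'2]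
  have hq1 : ∀ t, t ≠ (a₁, none) → c t.2 (q t).2 = 0 → (q t).1 = t.1 := by
    rintro ⟨a, i⟩ - h0
    rw [hq2] at h0
    rw [hq]
    simp only at h0 ⊢
    by_cases hi : i = i₀
    · subst hi
      have hnone : ρ (s (a, i)).1 i = none := hc.right_unique _ _ _ h0 hi₀
      have hne : (s (a, i)).1 ≠ a₁ := by
        intro h
        rw [h, hρ1] at hnone
        obtain ⟨x, rfl⟩ := Option.ne_none_iff_exists'.1 hi₀n
        simp at hnone
      rw [hnone]
      simp only [s, s', Equiv.swap_apply_def] at hne ⊢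
      by_cases h1 : a = a₁
      · subst h1
        simp at hne ⊢
        simp [hne]
      · by_cases h2 : a = a₂
        · subst h2
          simp [h1] at hne
        · simp [h1, h2]
    · have hsi : s (a, i) = (a, i) :=
        Equiv.swap_apply_of_ne_of_ne (by simp [hi]) (by simp [hi])
      rw [hsi] at h0 ⊢
      have hnone : ρ a i ≠ none := fun h => hi (hc.left_unique _ _ _ (h ▸ h0) hi₀)
      rw [Equiv.swap_apply_of_ne_of_ne (by simp [hnone]) (by simp [hnone])]
  have hd' : (0 : ℝ) < d := by exact_mod_cast hd
  have hcardR : (d : ℝ) + 1 = Fintype.card A * (Fintype.card N + 1) := by exact_mod_cast hcard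
  refine (wasserstein_le_of_assignment K (T := A × Option N) P (Q ∘ q)
    (w := fun t => if t = (a₁, none) then 0 else (1 - 0) / d)
    (fun t => by split_ifs; exacts [le_rfl, div_nonneg (by norm_num) hd'.le])
    ?_ (fun z => idleMeasure_eq_sum K hK.injective_left _ hK.range_left hK.degree_left 0 z)
    (fun z => ?_) (c := fun t => c t.2 (q t).2) (fun t ht => ?_)).trans (le_of_eq ?_)
  · rw [sum_weight, ← hcardR]
    field_simp
    simp
  · rw [idleMeasure_eq_sum K hK.injective_right _ hK.range_right hK.degree_right 0 z,
      ← q.sum_comp]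
    refine Finset.sum_congr rfl fun t _ => ?_
    have : q t = (a₂, none) ↔ t = (a₁, none) := by rw [← hqc, q.injective.eq_iff]
    simp only [this, Function.comp]
  · have htn : t ≠ (a₁, none) := fun h => by simp [h] at ht
    exact hK.edist_le t.1 t.2 (q t).1 (q t).2 fun h => (hq1 t htn h).symm
  · congr 1
    rw [sum_ite_eq_none_weight (I := N) a₁ (fun a i => (c i (q (a, i)).2 : ℝ)), hqc, hc.none_none]
    have h2 : ∑ a, ∑ i, (c i (q (a, i)).2 : ℝ) = T₀ + 1 + (Fintype.card A - 1) * T₁ := by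
      rw [← Fintype.sum_prod_type' (f := fun a i => (c i (q (a, i)).2 : ℝ))]
      have h3 : ∀ t : A × Option N, (c t.2 (q (t.1, t.2)).2 : ℝ) =
          (fun u : A × Option N => (c u.2 (ρ u.1 u.2) : ℝ)) (s t) := fun t => by
        simp only [hq2, hs2]
      rw [Finset.sum_congr rfl fun t _ => h3 t,
        Equiv.sum_comp s (fun u : A × Option N => (c u.2 (ρ u.1 u.2) : ℝ)), Fintype.sum_prod_type,
        ← Finset.add_sum_erase _ _ (Finset.mem_univ a₁)]
      have h4 : ∑ i, (c i (ρ a₁ i) : ℝ) = T₀ + 1 := by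
        rw [Fintype.sum_option, hρ1, ← hτ]
        simp [hc.none_none]
        ring
      have h5 : ∀ a ∈ Finset.univ.erase a₁, ∑ i, (c i (ρ a i) : ℝ) = T₁ := fun a ha => by
        rw [hρ a (Finset.mem_erase.1 ha).1, ← hσ]
        push_cast
        rfl
      rw [h4, Finset.sum_congr rfl h5, Finset.sum_const, Finset.card_erase_of_mem
        (Finset.mem_univ _), nsmul_eq_mul, Nat.cast_sub (Finset.card_pos.2 ⟨a₁, Finset.mem_univ _⟩)]
      simp
    rw [h2]
    push_cast
    field_simp
    ring

/-- One optimal bijection of closed neighbourhoods is used in every sheet, and the surplus α - β,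
with β = (1 - α) / d, goes from centre to centre at cost 1. It is carried by the extra particle
`none`. -/
theorem IsLift.wasserstein_le [Fintype N'] (hK : IsLift K c P Q a₁ a₂ d) (hc : IsEdgeCost c)
    (hd : 0 < d) (hcard : d + 1 = Fintype.card A * (Fintype.card N + 1))
    {T₁ : ℕ} (h₁ : IsMinCost c T₁) {α : ℝ} (hα : α < 1) (hα' : (1 - α) / d ≤ α) :
    wasserstein K (idleMeasure K α (P (a₁, none))) (idleMeasure K α (Q (a₂, none))) ≤
      ENNReal.ofReal (Fintype.card A * ((1 - α) / d) * T₁ + (α - (1 - α) / d)) := by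
  classical
  obtain ⟨σ, hσ⟩ := h₁.1
  have hd' : (0 : ℝ) < d := by exact_mod_cast hd
  have hcardR : (d : ℝ) + 1 = Fintype.card A * (Fintype.card N + 1) := by exact_mod_cast hcard
  have hβ : (0 : ℝ) < (1 - α) / d := div_pos (by linarith) hd'
  let q : A × Option N ≃ A × Option N' := Equiv.prodCongr (Equiv.refl A) σ
  refine (wasserstein_le_of_assignment K (T := Option (A × Option N))
    (fun t => t.elim (P (a₁, none)) P) (fun t => t.elim (Q (a₂, none)) (Q ∘ q))
    (w := fun t => t.elim (α - (1 - α) / d) fun _ => (1 - α) / d)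
    (fun t => by cases t; exacts [sub_nonneg.2 hα', hβ.le])
    ?_ (fun z => ?_) (fun z => ?_)
    (c := fun t => t.elim 1 fun s => c s.2 (q s).2) (fun t ht => ?_)).trans (le_of_eq ?_)
  · rw [Fintype.sum_option]
    simp only [Option.elim_none, Option.elim_some, Finset.sum_const, Finset.card_univ,
      Fintype.card_prod, Fintype.card_option, nsmul_eq_mul]
    push_cast
    rw [← hcardR]
    field_simp
    linarith
  · rw [idleMeasure_eq_sum K hK.injective_left _ hK.range_left hK.degree_left, sum_ite_weight,
      Fintype.sum_option]
    rfl
  · rw [idleMeasure_eq_sum K hK.injective_right _ hK.range_right hK.degree_right, sum_ite_weight,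
      Fintype.sum_option, ← q.sum_comp]
    rfl
  · cases t with
    | none =>
      have := hK.edist_le a₁ none a₂ none (by simp [hc.none_none])
      rwa [hc.none_none] at this
    | some t => exact hK.edist_le t.1 t.2 (q t).1 (q t).2 fun _ => rfl
  · congr 1
    rw [Fintype.sum_option, Fintype.sum_prod_type]
    simp only [Option.elim_none, Option.elim_some, q, Equiv.prodCongr_apply, Prod.map,
      Equiv.refl_apply, ← Finset.sum_mul]
    rw [← hσ]
    push_cast
    simp only [Finset.sum_const, Finset.card_univ, nsmul_eq_mul]
    ring

end

theorem IsLift.dist_eq_one {U A N N' : Type*} {K : SimpleGraph U} [K.LocallyFinite]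
    {c : Option N → Option N' → ℕ} {P : A × Option N → U} {Q : A × Option N' → U} {a₁ a₂ : A}
    {d : ℕ} (hK : IsLift K c P Q a₁ a₂ d) (hc : c none none = 1) :
    K.dist (P (a₁, none)) (Q (a₂, none)) = 1 := by
  have h1 := hK.edist_le a₁ none a₂ none (by simp [hc])
  have h2 := hK.le_edist a₁ none a₂ none
  rw [hc] at h1 h2
  simp [SimpleGraph.dist, le_antisymm h1 h2]

/-! ### Curvatures in terms of T₀ and T₁ -/

section
variable {U A N N' : Type*} [Fintype A] [Fintype N] [Fintype N'] {K : SimpleGraph U}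
  [K.LocallyFinite] {c : Option N → Option N' → ℕ} {P : A × Option N → U} {Q : A × Option N' → U}
  {a₁ a₂ : A} {d : ℕ}

theorem IsLift.ricciCurvature_zero (hK : IsLift K c P Q a₁ a₂ d) (hc : IsEdgeCost c)
    (hd : 0 < d) (hcard : d + 1 = Fintype.card A * (Fintype.card N + 1))
    {T₀ T₁ : ℕ} (h₀ : IsMinCost (fun x y => c (some x) (some y)) T₀) (h₁ : IsMinCost c T₁) :
    ricciCurvature K 0 (P (a₁, none)) (Q (a₂, none)) =
      1 - (T₀ + (Fintype.card A - 1) * T₁) / d := by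
  have hA : (1 : ℝ) ≤ Fintype.card A := by exact_mod_cast Fintype.card_pos_iff.2 ⟨a₁⟩
  rw [ricciCurvature, le_antisymm (hK.wasserstein_zero_le hc hd hcard h₀ h₁)
    (hK.le_wasserstein_zero hc hd h₀ h₁), hK.dist_eq_one hc.none_none,
    ENNReal.toReal_ofReal, Nat.cast_one, div_one]
  exact div_nonneg (add_nonneg (Nat.cast_nonneg _)
    (mul_nonneg (by linarith) (Nat.cast_nonneg _))) (Nat.cast_nonneg _)

/-- For α close to 1 the upper and lower bounds agree and κ_α is an exact multiple of 1 - α, so the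
quotient is eventually constant. -/
theorem IsLift.hasLLYCurvature (hK : IsLift K c P Q a₁ a₂ d) (hc : IsEdgeCost c)
    (hd : 0 < d) (hcard : d + 1 = Fintype.card A * (Fintype.card N + 1))
    {T₀ T₁ : ℕ} (h₀ : IsMinCost (fun x y => c (some x) (some y)) T₀) (h₁ : IsMinCost c T₁) :
    HasLLYCurvature K (P (a₁, none)) (Q (a₂, none)) ((d + 1 - Fintype.card A * T₁) / d) := by
  have hd' : (0 : ℝ) < d := by exact_mod_cast hd
  have hlim : Filter.Tendsto (fun α : ℝ => α - (Fintype.card A + 1) * ((1 - α) / d)) (𝓝[<] 1)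
      (𝓝 (1 - (Fintype.card A + 1) * ((1 - 1) / d))) := by
    refine (Continuous.tendsto ?_ 1).mono_left nhdsWithin_le_nhds
    fun_prop
  have hev : ∀ᶠ α : ℝ in 𝓝[<] 1, 0 < α - (Fintype.card A + 1) * ((1 - α) / d) :=
    hlim.eventually_const_lt (by simp)
  refine tendsto_const_nhds.congr' ?_
  filter_upwards [hev, self_mem_nhdsWithin] with α hα hα1
  have hα1' : α < 1 := hα1
  have hβ : (0 : ℝ) < (1 - α) / d := div_pos (by linarith) hd'
  have hA : (0 : ℝ) ≤ Fintype.card A := Nat.cast_nonneg _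
  have hAβ := mul_nonneg hA hβ.le
  have hle : (1 - α) / d ≤ α := by linarith
  rw [ricciCurvature, le_antisymm (hK.wasserstein_le hc hd hcard h₁ hα1' hle)
    (hK.le_wasserstein hc hd h₀ h₁ hα1' (by linarith)), hK.dist_eq_one hc.none_none,
    ENNReal.toReal_ofReal, Nat.cast_one, div_one, eq_div_iff (by linarith)]
  · field_simp
    ring
  · exact add_nonneg (mul_nonneg hAβ (Nat.cast_nonneg _)) (by linarith)

end

theorem HasLLYCurvature.llyCurvature_eq {V : Type*} {G : SimpleGraph V} [G.LocallyFinite]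
    {x y : V} {k : ℝ} (h : HasLLYCurvature G x y k) : llyCurvature G x y = k :=
  Filter.Tendsto.limUnder_eq h

/-! ### Closed neighbourhoods and distances across an edge -/

/-- The closed neighbourhood of `y`, with `none` as the centre. -/
def closedNeighbor {W : Type*} (H : SimpleGraph W) (y : W) : Option (H.neighborSet y) → W :=
  fun i => i.elim y Subtype.val

section
variable {W : Type*} {H : SimpleGraph W}

@[simp] theorem closedNeighbor_none (y : W) : closedNeighbor H y none = y := rfl

@[simp] theorem closedNeighbor_some (y : W) (x : H.neighborSet y) :
    closedNeighbor H y (some x) = x := rfl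

theorem closedNeighbor_injective (y : W) : Function.Injective (closedNeighbor H y) := by
  rintro (_ | x) (_ | x') h
  · rfl
  · exact absurd h x'.2.ne
  · exact absurd h.symm x.2.ne
  · exact congrArg some (Subtype.ext h)

theorem mem_range_closedNeighbor {y z : W} :
    z ∈ Set.range (closedNeighbor H y) ↔ z = y ∨ H.Adj y z := by
  constructor
  · rintro ⟨_ | x, rfl⟩
    exacts [Or.inl rfl, Or.inr x.2]
  · rintro (rfl | h)
    exacts [⟨none, rfl⟩, ⟨some ⟨z, h⟩, rfl⟩]

theorem closedNeighbor_eq_or_adj (y : W) (i : Option (H.neighborSet y)) :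
    closedNeighbor H y i = y ∨ H.Adj y (closedNeighbor H y i) :=
  mem_range_closedNeighbor.1 ⟨i, rfl⟩

theorem edist_closedNeighbor_le (y : W) (i : Option (H.neighborSet y)) :
    H.edist y (closedNeighbor H y i) ≤ 1 := by
  rw [SimpleGraph.edist_le_one_iff_adj_or_eq]
  exact (closedNeighbor_eq_or_adj y i).symm.imp id Eq.symm

/-- The distances between the closed neighbourhoods of `y₁` and `y₂`. -/
noncomputable def edgeCost (H : SimpleGraph W) (y₁ y₂ : W) :
    Option (H.neighborSet y₁) → Option (H.neighborSet y₂) → ℕ :=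
  fun i j => H.dist (closedNeighbor H y₁ i) (closedNeighbor H y₂ j)

variable {y₁ y₂ : W}

theorem reachable_closedNeighbor (h : H.Adj y₁ y₂) (i : Option (H.neighborSet y₁))
    (j : Option (H.neighborSet y₂)) :
    H.Reachable (closedNeighbor H y₁ i) (closedNeighbor H y₂ j) := by
  have h1 : ∀ y (k : Option (H.neighborSet y)), H.Reachable y (closedNeighbor H y k) := fun y k =>
    SimpleGraph.reachable_of_edist_ne_top
      (ne_top_of_le_ne_top (by simp) (edist_closedNeighbor_le y k))
  exact ((h1 y₁ i).symm.trans h.reachable).trans (h1 y₂ j)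

theorem coe_edgeCost (h : H.Adj y₁ y₂) (i : Option (H.neighborSet y₁))
    (j : Option (H.neighborSet y₂)) :
    (edgeCost H y₁ y₂ i j : ℕ∞) = H.edist (closedNeighbor H y₁ i) (closedNeighbor H y₂ j) :=
  (reachable_closedNeighbor h i j).coe_dist_eq_edist

theorem edgeCost_eq_zero (h : H.Adj y₁ y₂) {i : Option (H.neighborSet y₁)}
    {j : Option (H.neighborSet y₂)} :
    edgeCost H y₁ y₂ i j = 0 ↔ closedNeighbor H y₁ i = closedNeighbor H y₂ j :=
  (reachable_closedNeighbor h i j).dist_eq_zero_iff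

theorem isEdgeCost_edgeCost (h : H.Adj y₁ y₂) : IsEdgeCost (edgeCost H y₁ y₂) where
  none_none := SimpleGraph.dist_eq_one_iff_adj.2 h
  right_unique i j j' h1 h2 := by
    rw [edgeCost_eq_zero h] at h1 h2
    exact closedNeighbor_injective _ (h1.symm.trans h2)
  left_unique i i' j h1 h2 := by
    rw [edgeCost_eq_zero h] at h1 h2
    exact closedNeighbor_injective _ (h1.trans h2.symm)
  triangle i j hij u v := by
    rw [edgeCost_eq_zero h] at hij
    have := (reachable_closedNeighbor h u j).dist_triangle_left (closedNeighbor H y₂ v)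
    rw [← hij] at this
    simpa only [edgeCost, hij] using this
  le_three i j := by
    have h1 := SimpleGraph.edist_triangle (G := H) (u := closedNeighbor H y₁ i) (v := y₁)
      (w := closedNeighbor H y₂ j)
    have h2 := SimpleGraph.edist_triangle (G := H) (u := y₁) (v := y₂)
      (w := closedNeighbor H y₂ j)
    have h3 := edist_closedNeighbor_le y₁ i
    have h4 := edist_closedNeighbor_le y₂ j
    rw [SimpleGraph.edist_comm] at h3
    have h5 := SimpleGraph.edist_eq_one_iff_adj.2 h
    have : (edgeCost H y₁ y₂ i j : ℕ∞) ≤ 1 + (1 + 1) := by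
      rw [coe_edgeCost h]
      exact h1.trans (add_le_add h3 (h2.trans (add_le_add h5.le h4)))
    exact_mod_cast this
  two_le_left i hi := by
    have hr := reachable_closedNeighbor h i none
    have hn : closedNeighbor H y₁ i ∉ Set.range (closedNeighbor H y₂) := fun ⟨j, hj⟩ =>
      hi j ((edgeCost_eq_zero h).2 hj.symm)
    rw [mem_range_closedNeighbor, not_or] at hn
    exact hr.one_lt_dist_of_ne_of_not_adj hn.1 fun h' => hn.2 h'.symm
  two_le_right j hj := by
    have hr := reachable_closedNeighbor h none j
    have hn : closedNeighbor H y₂ j ∉ Set.range (closedNeighbor H y₁) := fun ⟨i, hi⟩ =>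
      hj i ((edgeCost_eq_zero h).2 hi)
    rw [mem_range_closedNeighbor, not_or] at hn
    exact hr.one_lt_dist_of_ne_of_not_adj (Ne.symm hn.1) hn.2
  exists_left := ⟨some ⟨y₂, h⟩, (edgeCost_eq_zero h).2 rfl⟩
  exists_right := ⟨some ⟨y₁, h.symm⟩, (edgeCost_eq_zero h).2 rfl⟩

theorem isLift_closedNeighbor [H.LocallyFinite] (h : H.Adj y₁ y₂) {d : ℕ}
    (h₁ : H.degree y₁ = d) (h₂ : H.degree y₂ = d) :
    IsLift H (edgeCost H y₁ y₂) (fun t : Unit × _ => closedNeighbor H y₁ t.2)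
      (fun t : Unit × _ => closedNeighbor H y₂ t.2) () () d where
  injective_left s t hst := Prod.ext rfl (closedNeighbor_injective _ hst)
  injective_right s t hst := Prod.ext rfl (closedNeighbor_injective _ hst)
  range_left z := by
    rw [← mem_range_closedNeighbor]
    simp [Set.mem_range]
  range_right z := by
    rw [← mem_range_closedNeighbor]
    simp [Set.mem_range]
  degree_left := h₁
  degree_right := h₂
  le_edist _ i _ j := (coe_edgeCost h i j).le
  edist_le _ i _ j _ := (coe_edgeCost h i j).ge

/-- Curvatures of an edge one of whose ends has its closed neighbourhood inside that of the
other. -/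
theorem isMinCost_edgeCost_of_subset [H.LocallyFinite] (h : H.Adj y₁ y₂)
    (hdeg : H.degree y₁ = H.degree y₂) (hsub : ∀ z, H.Adj y₁ z → z = y₂ ∨ H.Adj y₂ z) :
    IsMinCost (edgeCost H y₁ y₂) 0 ∧
      IsMinCost (fun x y => edgeCost H y₁ y₂ (some x) (some y)) 1 := by
  classical
  have hmem : ∀ i, ∃ j, closedNeighbor H y₂ j = closedNeighbor H y₁ i := fun i => by
    refine mem_range_closedNeighbor.2 ?_
    rcases closedNeighbor_eq_or_adj y₁ i with h' | h'
    · rw [h']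
      exact Or.inr h.symm
    · exact hsub _ h'
  choose f hf using hmem
  have hinj : Function.Injective f := fun i i' hii => closedNeighbor_injective _ (by
    rw [← hf, ← hf, hii])
  have hcard : Fintype.card (Option (H.neighborSet y₁)) =
      Fintype.card (Option (H.neighborSet y₂)) := by
    simp only [Fintype.card_option, SimpleGraph.card_neighborSet_eq_degree, hdeg]
  let σ := Equiv.ofBijective f ((Fintype.bijective_iff_injective_and_card f).2 ⟨hinj, hcard⟩)
  have hσ : ∀ i, edgeCost H y₁ y₂ i (σ i) = 0 := fun i => (edgeCost_eq_zero h).2 (hf i).symm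
  have hz : IsMinCost (edgeCost H y₁ y₂) 0 := ⟨⟨σ, by simp [hσ]⟩, fun _ _ => Nat.zero_le _⟩
  refine ⟨hz, ?_⟩
  have hc := isEdgeCost_edgeCost h
  let i₀ : H.neighborSet y₁ := ⟨y₂, h⟩
  let j₀ : H.neighborSet y₂ := ⟨y₁, h.symm⟩
  have hi₀ : edgeCost H y₁ y₂ (some i₀) none = 0 := (edgeCost_eq_zero h).2 rfl
  have hj₀ : edgeCost H y₁ y₂ none (some j₀) = 0 := (edgeCost_eq_zero h).2 rfl
  have hσi : σ (some i₀) = none := hc.right_unique _ _ _ (hσ _) hi₀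
  have hσn : σ none = some j₀ := hc.right_unique _ _ _ (hσ _) hj₀
  -- σ identifies equal vertices. Making it fix the centre pairs y₂ with y₁ at cost 1 and leaves the
  -- rest at cost 0. Cost 0 is impossible, since y₂ is not its own neighbour.
  let σ' := (Equiv.swap none (some i₀)).trans σ
  have hσ'n : σ' none = none := by simp [σ', hσi]
  have hσ'i : σ' (some i₀) = some j₀ := by simp [σ', hσn]
  obtain ⟨τ, hτ⟩ := exists_some_eq_of_none σ' hσ'n
  constructor
  · refine ⟨τ, ?_⟩
    simp only
    rw [Finset.sum_eq_single i₀]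
    · rw [← hτ, hσ'i]
      exact SimpleGraph.dist_eq_one_iff_adj.2 h.symm
    · intro x _ hx
      rw [← hτ]
      have : σ' (some x) = σ (some x) := by
        simp [σ', Equiv.swap_apply_of_ne_of_ne (Option.some_ne_none x)
          (fun h' => hx (Option.some_injective _ h'))]
      rw [this, hσ]
    · simp
  · rintro _ ⟨ρ, rfl⟩
    refine le_trans ?_ (Finset.single_le_sum (f := fun x => edgeCost H y₁ y₂ (some x) (some (ρ x)))
      (fun _ _ => Nat.zero_le _) (Finset.mem_univ i₀))
    refine Nat.one_le_iff_ne_zero.2 fun h0 => ?_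
    exact absurd (hc.right_unique _ _ _ h0 hi₀) (by simp)

theorem curvature_of_subset [H.LocallyFinite] (h : H.Adj y₁ y₂) {d : ℕ}
    (h₁ : H.degree y₁ = d) (h₂ : H.degree y₂ = d)
    (hsub : ∀ z, H.Adj y₁ z → z = y₂ ∨ H.Adj y₂ z) :
    HasLLYCurvature H y₁ y₂ ((d + 1) / d) ∧ ricciCurvature H 0 y₁ y₂ = (d - 1) / d := by
  have hd : 0 < d := h₁ ▸ (SimpleGraph.degree_pos_iff_exists_adj _ _).2 ⟨y₂, h⟩
  have hd' : (d : ℝ) ≠ 0 := by exact_mod_cast hd.ne'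
  obtain ⟨hm₁, hm₀⟩ := isMinCost_edgeCost_of_subset h (h₁.trans h₂.symm) hsub
  have hK := isLift_closedNeighbor h h₁ h₂
  have hc := isEdgeCost_edgeCost h
  have hcard : d + 1 = Fintype.card Unit * (Fintype.card (H.neighborSet y₁) + 1) := by
    rw [Fintype.card_unit, one_mul, SimpleGraph.card_neighborSet_eq_degree, h₁]
  constructor
  · have := hK.hasLLYCurvature hc hd hcard hm₀ hm₁
    simpa using this
  · have := hK.ricciCurvature_zero hc hd hcard hm₀ hm₁
    simp only [closedNeighbor_none] at this
    rw [this]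
    field_simp
    simp

end

/-! ### The strong product with a complete graph -/

section
variable {V W : Type*} {H : SimpleGraph W}

/-- Projecting a walk to H turns each step into an edge or a stay. -/
theorem edist_snd_le (G : SimpleGraph V) (p q : V × W) :
    H.edist p.2 q.2 ≤ (strongProd G H).edist p q := by
  by_cases h : (strongProd G H).edist p q = ⊤
  · rw [h]
    exact le_top
  obtain ⟨w, hw⟩ := SimpleGraph.exists_walk_of_edist_ne_top h
  rw [← hw]
  clear hw h
  induction w with
  | nil => simp
  | @cons u v w huv w' ih =>
    refine SimpleGraph.edist_triangle.trans
      ((add_le_add (SimpleGraph.edist_le_one_iff_adj_or_eq.2 huv.2.2.symm) ih).trans ?_)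
    rw [SimpleGraph.Walk.length_cons, Nat.cast_add, Nat.cast_one, add_comm]

theorem strongProd_top_adj {p q : V × W} :
    (strongProd ⊤ H).Adj p q ↔ p ≠ q ∧ (p.2 = q.2 ∨ H.Adj p.2 q.2) := by
  refine ⟨fun h => ⟨h.1, h.2.2⟩, fun h => ⟨h.1, ?_, h.2⟩⟩
  exact em _

/-- A walk in H lifts with the change of sheet made on its first step. A walk of length 0 has no
such step, hence the condition on p and q. -/
theorem edist_strongProd_top_le (p q : V × W) (hpq : p.2 = q.2 → p.1 = q.1) :
    (strongProd ⊤ H).edist p q ≤ H.edist p.2 q.2 := by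
  by_cases h : H.edist p.2 q.2 = ⊤
  · rw [h]
    exact le_top
  obtain ⟨w, hw⟩ := SimpleGraph.exists_walk_of_edist_ne_top h
  rw [← hw]
  obtain ⟨a, u⟩ := p
  obtain ⟨b, v⟩ := q
  simp only at w hpq ⊢
  clear hw h
  induction w generalizing a with
  | nil => simp [hpq rfl]
  | @cons u v w huv w' ih =>
    have hadj : (strongProd ⊤ H).Adj (a, u) (b, v) :=
      strongProd_top_adj.2 ⟨fun h => huv.ne (congrArg Prod.snd h), Or.inr huv⟩
    refine SimpleGraph.edist_triangle.trans
      ((add_le_add (SimpleGraph.edist_eq_one_iff_adj.2 hadj).le (ih b fun _ => rfl)).trans ?_)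
    rw [SimpleGraph.Walk.length_cons, Nat.cast_add, Nat.cast_one, add_comm]

theorem degree_add_one_eq_card {U T : Type*} [Fintype T] (K : SimpleGraph U) [K.LocallyFinite]
    {P : T → U} (hP : Function.Injective P) (t₀ : T)
    (hr : ∀ z, z ∈ Set.range P ↔ z = P t₀ ∨ K.Adj (P t₀) z) :
    K.degree (P t₀) + 1 = Fintype.card T := by
  have hrange : Set.range P = Set.range (closedNeighbor K (P t₀)) := by
    ext z
    rw [hr, mem_range_closedNeighbor]
  rw [← SimpleGraph.card_neighborSet_eq_degree, ← Fintype.card_option]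
  exact Fintype.card_congr ((Equiv.ofInjective _ (closedNeighbor_injective _)).trans
    ((Equiv.setCongr hrange.symm).trans (Equiv.ofInjective P hP).symm))

/-- The closed neighbourhood of `(x, y)` in the strong product of a complete graph with `H`, which
does not depend on `x`. -/
def prodClosedNeighbor (V : Type*) (H : SimpleGraph W) (y : W) :
    V × Option (H.neighborSet y) → V × W :=
  fun t => (t.1, closedNeighbor H y t.2)

theorem prodClosedNeighbor_injective (y : W) :
    Function.Injective (prodClosedNeighbor V H y) := by
  rintro ⟨a, i⟩ ⟨b, j⟩ h
  simp only [prodClosedNeighbor, Prod.mk.injEq] at h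
  rw [h.1, closedNeighbor_injective _ h.2]

theorem mem_range_prodClosedNeighbor (x : V) (y : W) (z : V × W) :
    z ∈ Set.range (prodClosedNeighbor V H y) ↔
      z = prodClosedNeighbor V H y (x, none) ∨
        (strongProd ⊤ H).Adj (prodClosedNeighbor V H y (x, none)) z := by
  have h1 : z ∈ Set.range (prodClosedNeighbor V H y) ↔ z.2 ∈ Set.range (closedNeighbor H y) := by
    constructor
    · rintro ⟨t, rfl⟩
      exact ⟨t.2, rfl⟩
    · rintro ⟨i, hi⟩
      exact ⟨(z.1, i), Prod.ext rfl hi⟩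
  rw [h1, mem_range_closedNeighbor, strongProd_top_adj]
  simp only [prodClosedNeighbor, closedNeighbor_none]
  by_cases h : z = (x, y)
  · simp [h]
  · simp [h, Ne.symm h, eq_comm]

variable [H.LocallyFinite] [(⊤ : SimpleGraph V).LocallyFinite]

theorem degree_strongProd_top [Fintype V] (x : V) (y : W) :
    (strongProd ⊤ H).degree (x, y) + 1 = Fintype.card V * (H.degree y + 1) := by
  have := degree_add_one_eq_card (strongProd ⊤ H) (prodClosedNeighbor_injective (V := V) y)
    (x, none) (mem_range_prodClosedNeighbor x y)
  rw [Fintype.card_prod, Fintype.card_option, SimpleGraph.card_neighborSet_eq_degree] at this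
  exact this

theorem isLift_strongProd_top (x₁ x₂ : V) {y₁ y₂ : W} (h : H.Adj y₁ y₂) {d : ℕ}
    (h₁ : (strongProd ⊤ H).degree (x₁, y₁) = d) (h₂ : (strongProd ⊤ H).degree (x₂, y₂) = d) :
    IsLift (strongProd ⊤ H) (edgeCost H y₁ y₂) (prodClosedNeighbor V H y₁)
      (prodClosedNeighbor V H y₂) x₁ x₂ d where
  injective_left := prodClosedNeighbor_injective _
  injective_right := prodClosedNeighbor_injective _
  range_left := mem_range_prodClosedNeighbor x₁ y₁
  range_right := mem_range_prodClosedNeighbor x₂ y₂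
  degree_left := h₁
  degree_right := h₂
  le_edist a i b j := by
    rw [coe_edgeCost h]
    exact edist_snd_le ⊤ (prodClosedNeighbor V H y₁ (a, i)) (prodClosedNeighbor V H y₂ (b, j))
  edist_le a i b j hij := by
    rw [edgeCost_eq_zero h] at hij
    rw [coe_edgeCost h]
    exact edist_strongProd_top_le (prodClosedNeighbor V H y₁ (a, i))
      (prodClosedNeighbor V H y₂ (b, j)) hij

end

/-- In a complete graph a single closed neighbourhood is everything, so local finiteness forces
finiteness. -/
theorem exists_fintype_card_eq {V : Type*} [(⊤ : SimpleGraph V).LocallyFinite] (x : V) {d : ℕ}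
    (hd : (⊤ : SimpleGraph V).degree x = d) : ∃ _ : Fintype V, Fintype.card V = d + 1 := by
  have hbij : Function.Bijective (closedNeighbor (⊤ : SimpleGraph V) x) :=
    ⟨closedNeighbor_injective x, fun z => mem_range_closedNeighbor.2 (by
      rw [SimpleGraph.top_adj, ne_comm]
      exact em _)⟩
  let : Fintype V := Fintype.ofEquiv _ (Equiv.ofBijective _ hbij)
  refine ⟨this, ?_⟩
  rw [← Fintype.card_congr (Equiv.ofBijective _ hbij), Fintype.card_option,
    SimpleGraph.card_neighborSet_eq_degree, hd]

theorem adj_or_eq_of_remainingNeighbors_eq_empty {W : Type*} {H : SimpleGraph W}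
    {y₁ y₂ : W} (h : remainingNeighbors H y₁ y₂ = ∅) {z : W} (hz : H.Adj y₁ z) :
    z = y₂ ∨ H.Adj y₂ z := by
  by_contra hcon
  push Not at hcon
  have : z ∈ remainingNeighbors H y₁ y₂ := by
    refine ⟨hz, ?_⟩
    rintro (⟨-, h2⟩ | h1)
    exacts [hcon.2 h2, hcon.1 h1]
  rw [h] at this
  exact this

end GraphCurvature

/-! ### The corollary -/

open GraphCurvature in
theorem mainTheorem4 {V W : Type*} (G : SimpleGraph V) (H : SimpleGraph W)
    [G.LocallyFinite] [H.LocallyFinite] (dG dH d : ℕ)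
    (hG : G = ⊤) (hdG : G.IsRegularOfDegree dG) (hdH : H.IsRegularOfDegree dH)
    (hd : d = dG + dH + dG * dH) :
    (GraphCurvature.strongProd G H).IsRegularOfDegree d ∧
    ∀ (x₁ x₂ : V) (y₁ y₂ : W), (GraphCurvature.strongProd G H).Adj (x₁, y₁) (x₂, y₂) →
      -- the limit defining the Lin–Lu–Yau curvature of the edge exists
      GraphCurvature.HasLLYCurvature (GraphCurvature.strongProd G H) (x₁, y₁) (x₂, y₂)
        (GraphCurvature.llyCurvature (GraphCurvature.strongProd G H) (x₁, y₁) (x₂, y₂)) ∧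
      ((GraphCurvature.remainingNeighbors H y₁ y₂).Nonempty →
        H.Adj y₁ y₂ ∧
        GraphCurvature.HasLLYCurvature H y₁ y₂ (GraphCurvature.llyCurvature H y₁ y₂) ∧
        GraphCurvature.llyCurvature (GraphCurvature.strongProd G H) (x₁, y₁) (x₂, y₂) =
          ((dH : ℝ) * ((dG : ℝ) + 1)) / (d : ℝ) * GraphCurvature.llyCurvature H y₁ y₂ ∧
        GraphCurvature.ricciCurvature (GraphCurvature.strongProd G H) 0 (x₁, y₁) (x₂, y₂) =
          ((dG : ℝ) * (dH : ℝ)) / (d : ℝ) * GraphCurvature.llyCurvature H y₁ y₂ +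
            (dH : ℝ) / (d : ℝ) * GraphCurvature.ricciCurvature H 0 y₁ y₂) ∧
      (GraphCurvature.remainingNeighbors H y₁ y₂ = ∅ →
        GraphCurvature.llyCurvature (GraphCurvature.strongProd G H) (x₁, y₁) (x₂, y₂) =
          ((d : ℝ) + 1) / (d : ℝ) ∧
        GraphCurvature.ricciCurvature (GraphCurvature.strongProd G H) 0 (x₁, y₁) (x₂, y₂) =
          ((d : ℝ) - 1) / (d : ℝ)) := by
  subst hG
  have hreg : (strongProd (⊤ : SimpleGraph V) H).IsRegularOfDegree d := by
    rintro ⟨x, y⟩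
    obtain ⟨_, hcard⟩ := exists_fintype_card_eq x (hdG x)
    have := degree_strongProd_top x y (H := H)
    rw [hcard, hdH y] at this
    have h2 : (dG + 1) * (dH + 1) = d + 1 := by rw [hd]; ring
    omega
  refine ⟨hreg, fun x₁ x₂ y₁ y₂ hadj => ?_⟩
  obtain ⟨_, hcard⟩ := exists_fintype_card_eq x₁ (hdG x₁)
  rcases (remainingNeighbors H y₁ y₂).eq_empty_or_nonempty with hR | hR
  -- This covers y₁ = y₂ too: membership in a closed neighbourhood of the product depends only on
  -- the second coordinate, so containment in H gives containment in the product.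
  · obtain ⟨hL, h0⟩ := curvature_of_subset hadj (hreg _) (hreg _) (fun z hz => by
      have hz' : z.2 = y₂ ∨ H.Adj y₂ z.2 := by
        rcases (strongProd_top_adj.1 hz).2 with h | h
        · rw [← h]
          exact (strongProd_top_adj.1 hadj).2.imp id SimpleGraph.Adj.symm
        · exact adj_or_eq_of_remainingNeighbors_eq_empty hR h
      rw [or_iff_not_imp_left]
      exact fun hne => strongProd_top_adj.2 ⟨Ne.symm hne, hz'.imp Eq.symm id⟩)
    refine ⟨hL.llyCurvature_eq.symm ▸ hL, fun hne => absurd hR hne.ne_empty, fun _ => ?_⟩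
    exact ⟨hL.llyCurvature_eq, h0⟩
  · have hne : y₁ ≠ y₂ := by
      rintro rfl
      obtain ⟨z, hz, hz'⟩ := hR
      exact hz' (Or.inl ⟨hz, hz⟩)
    have hH : H.Adj y₁ y₂ := (strongProd_top_adj.1 hadj).2.resolve_left hne
    have hdH0 : 0 < dH := hdH y₁ ▸ (SimpleGraph.degree_pos_iff_exists_adj _ _).2 ⟨y₂, hH⟩
    have hd0 : 0 < d := by rw [hd]; positivity
    have hdHR : (dH : ℝ) ≠ 0 := by exact_mod_cast hdH0.ne'
    have hd0R : (d : ℝ) ≠ 0 := by exact_mod_cast hd0.ne'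
    have hdR : (d : ℝ) = dG + dH + dG * dH := by exact_mod_cast hd
    have hcN : Fintype.card (H.neighborSet y₁) = dH := by
      rw [SimpleGraph.card_neighborSet_eq_degree, hdH y₁]
    have hcN' : Fintype.card (H.neighborSet y₂) = dH := by
      rw [SimpleGraph.card_neighborSet_eq_degree, hdH y₂]
    have e : H.neighborSet y₁ ≃ H.neighborSet y₂ := Fintype.equivOfCardEq (hcN.trans hcN'.symm)
    have hc := isEdgeCost_edgeCost hH
    obtain ⟨T₀, h₀⟩ := exists_isMinCost e
      (fun x y => edgeCost H y₁ y₂ (some x) (some y))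
    obtain ⟨T₁, h₁⟩ := exists_isMinCost (Equiv.optionCongr e) (edgeCost H y₁ y₂)
    have hKH := isLift_closedNeighbor hH (hdH y₁) (hdH y₂)
    have hcardH : dH + 1 = Fintype.card Unit * (Fintype.card (H.neighborSet y₁) + 1) := by
      rw [hcN, Fintype.card_unit, one_mul]
    have hKP := isLift_strongProd_top x₁ x₂ hH (hreg _) (hreg _)
    have hcardP : d + 1 = Fintype.card V * (Fintype.card (H.neighborSet y₁) + 1) := by
      rw [hcN, hcard, hd]; ring
    have hLH : HasLLYCurvature H y₁ y₂ _ := hKH.hasLLYCurvature hc hdH0 hcardH h₀ h₁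
    have hLP : HasLLYCurvature (strongProd (⊤ : SimpleGraph V) H) (x₁, y₁) (x₂, y₂) _ :=
      hKP.hasLLYCurvature hc hd0 hcardP h₀ h₁
    have h0H : ricciCurvature H 0 y₁ y₂ = _ := hKH.ricciCurvature_zero hc hdH0 hcardH h₀ h₁
    have h0P : ricciCurvature (strongProd (⊤ : SimpleGraph V) H) 0 (x₁, y₁) (x₂, y₂) = _ :=
      hKP.ricciCurvature_zero hc hd0 hcardP h₀ h₁
    -- All four curvatures are now expressed by the same T₀ and T₁, and the identities are algebra
    -- with n = d_G + 1.
    rw [hLH.llyCurvature_eq, hLP.llyCurvature_eq, h0H, h0P]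
    refine ⟨hLP, fun _ => ⟨hH, hLH, ?_, ?_⟩, fun h => absurd h hR.ne_empty⟩
    · rw [hcard, Fintype.card_unit]
      field_simp
      rw [hdR]
      push_cast
      ring
    · rw [hcard, Fintype.card_unit]
      field_simp
      rw [hdR]
      push_cast
      ring
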